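/- For $n\ge 2$ let $U_n(\mathbb Z)$ be the group of upper triangular $n\times n$ integer matrices with ones on the diagonal. For $1\le i\le n-1$ let $A_i\in U_n(\mathbb Z)$ be the matrix that differs from the identity only by an entry $1$ in position $(i,i+1)$, and let $S=\{A_1^{\pm1},\dots,A_{n-1}^{\pm1}\}$. For $\ell\ge 0$ let $V=V_1V_2\cdots V_\ell$ and $W=W_1W_2\cdots W_\ell$, where $V_1,\dots,V_\ell,W_1,\dots,W_\ell$ are independent and uniformly distributed on $S$ (so $V$ and $W$ are the endpoints of two independent simple random walks of length $\ell$, started at the identity, on the Cayley graph of $U_n(\mathbb Z)$ with respect to $S$), and let $G_{\ell,n}=\langle V,W\rangle\le U_n(\mathbb Z)$. Let $\ell=\ell(n)$ be a function of $n$ with values in the non-negative integers. Then: 1. If $\ell\in o(\sqrt n)$, then $\Pr(G_{\ell,n}\text{ is abelian})\to 1$ as $n\to\infty$. 2. If $\ell=c\sqrt n$ asymptotically, that is, if $\ell(n)/\sqrt n\to c$ for a real constant $c$, then $\Pr(G_{\ell,n}\text{ is abelian})\to e^{-2c^2}$ as $n\to\infty$. 3. If $\ell\in\omega(\sqrt n)$,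 that is, if $\sqrt n\in o(\ell)$, then $\Pr(G_{\ell,n}\text{ is not abelian})\to 1$ as $n\to\infty$. -/

import Mathlib

open Filter Topology MeasureTheory ProbabilityTheory Asymptotics

/-- The group `U_n(ℤ)` of upper triangular integer matrices of size `n × n` with ones on the
diagonal, as a subgroup of `SL_n(ℤ)`. -/
def unitriangularGroup (n : ℕ) : Subgroup (Matrix.SpecialLinearGroup (Fin n) ℤ) where
  carrier := {M | (∀ i j : Fin n, j < i → M i j = 0) ∧ ∀ i : Fin n, M i i = 1}
  one_mem' := by
    refine ⟨fun i j hij => ?_, fun i => ?_⟩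
    · simp [hij.ne']
    · simp
  mul_mem' := by
    rintro A B ⟨hA, hA1⟩ ⟨hB, hB1⟩
    refine ⟨fun i j hij => ?_, fun i => ?_⟩
    · rw [Matrix.SpecialLinearGroup.coe_mul, Matrix.mul_apply]
      refine Finset.sum_eq_zero fun k _ => ?_
      rcases lt_or_ge k i with h | h
      · rw [hA i k h, zero_mul]
      · rw [hB k j (hij.trans_le h), mul_zero]
    · rw [Matrix.SpecialLinearGroup.coe_mul, Matrix.mul_apply, Finset.sum_eq_single i]
      · rw [hA1, hB1, mul_one]
      · intro k _ hk
        rcases lt_or_gt_of_ne hk with h | h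
        · rw [hA i k h, zero_mul]
        · rw [hB k i h, mul_zero]
      · simp
  inv_mem' := by
    rintro A ⟨hA, hA1⟩
    have hinv : (A : Matrix (Fin n) (Fin n) ℤ) * ((A⁻¹ : Matrix.SpecialLinearGroup (Fin n) ℤ) :
        Matrix (Fin n) (Fin n) ℤ) = 1 := by
      rw [← Matrix.SpecialLinearGroup.coe_mul, mul_inv_cancel, Matrix.SpecialLinearGroup.coe_one]
    have hinv' : ((A⁻¹ : Matrix.SpecialLinearGroup (Fin n) ℤ) : Matrix (Fin n) (Fin n) ℤ) *
        (A : Matrix (Fin n) (Fin n) ℤ) = 1 := by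
      rw [← Matrix.SpecialLinearGroup.coe_mul, inv_mul_cancel, Matrix.SpecialLinearGroup.coe_one]
    have hT : ∀ i j : Fin n, j < i → (A⁻¹ : Matrix.SpecialLinearGroup (Fin n) ℤ) i j = 0 := by
      let _ : Invertible (A : Matrix (Fin n) (Fin n) ℤ) := ⟨_, hinv', hinv⟩
      have h := Matrix.blockTriangular_inv_of_blockTriangular
        (M := (A : Matrix (Fin n) (Fin n) ℤ)) (b := id) (fun i j hij => hA i j hij)
      rw [Matrix.inv_eq_right_inv hinv] at h
      exact fun i j hij => h hij
    refine ⟨hT, fun i => ?_⟩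
    have h := congrFun (congrFun hinv i) i
    rw [Matrix.mul_apply, Finset.sum_eq_single i, hA1, one_mul, Matrix.one_apply_eq] at h
    · exact h
    · intro k _ hk
      rcases lt_or_gt_of_ne hk with h' | h'
      · rw [hA i k h', zero_mul]
      · rw [hT k i h', mul_zero]
    · simp

/-- The elementary matrix `E_{i,j}` with `i < j`: the identity matrix with an additional `1` in
position `(i, j)`, as an element of `U_n(ℤ)`. -/
def elementaryMatrix {n : ℕ} (i j : Fin n) (hij : i < j) : unitriangularGroup n :=
  ⟨Matrix.SpecialLinearGroup.transvection hij.ne 1, by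
    refine ⟨fun a b hab => ?_, fun a => ?_⟩
    · rw [Matrix.SpecialLinearGroup.transvection_coe, Matrix.add_apply,
        Matrix.one_apply_ne hab.ne', Matrix.single_apply_of_ne, add_zero]
      rintro ⟨rfl, rfl⟩
      exact absurd hij hab.not_gt
    · rw [Matrix.SpecialLinearGroup.transvection_coe, Matrix.add_apply,
        Matrix.one_apply_eq, Matrix.single_apply_of_ne, add_zero]
      rintro ⟨rfl, h⟩
      exact hij.ne' h⟩

/-- The standard generating set `S = {A_1^{±1}, …, A_{n-1}^{±1}}` of `U_n(ℤ)`, where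
`A_i = E_{i,i+1}` are the superdiagonal elementary matrices. -/
def standardGenerators (n : ℕ) : Set (unitriangularGroup n) :=
  {g | ∃ (i j : Fin n) (hij : i < j), (j : ℕ) = i + 1 ∧
    (g = elementaryMatrix i j hij ∨ g = (elementaryMatrix i j hij)⁻¹)}

/-- A single step of the walk: an element of the standard generating set. -/
def Step (n : ℕ) : Type := standardGenerators n

/-- The discrete `σ`-algebra on the (finite) set of steps. -/
instance stepMeasurableSpace (n : ℕ) : MeasurableSpace (Step n) := ⊤

/-- The law of the sequence of steps of a simple random walk of length `ℓ` on the Cayley graph of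
`U_n(ℤ)` with respect to `S`: independent steps, each of them uniform on `S`. -/
noncomputable def wordLaw (n ℓ : ℕ) : Measure (Fin ℓ → Step n) :=
  Measure.pi fun _ => uniformOn (Set.univ : Set (Step n))

/-- The endpoint `V = V_1 V_2 ⋯ V_ℓ` of the walk, started at the identity, with the given steps. -/
def walkEnd {n ℓ : ℕ} (v : Fin ℓ → Step n) : unitriangularGroup n :=
  (List.ofFn fun k => (v k).1).prod

/-- The subgroup `G_{ℓ,n} = ⟨V, W⟩` of `U_n(ℤ)` generated by the endpoints of two walks. -/
def walkSubgroup {n ℓ : ℕ} (v w : Fin ℓ → Step n) : Subgroup (unitriangularGroup n) :=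
  Subgroup.closure {walkEnd v, walkEnd w}

/-- The probability that the random subgroup `G_{ℓ,n}`, generated by two independent simple random
walks of length `ℓ`, has the property `P`. -/
noncomputable def probSubgroup (n ℓ : ℕ) (P : Subgroup (unitriangularGroup n) → Prop) : ℝ :=
  ((wordLaw n ℓ).prod (wordLaw n ℓ)).real {p | P (walkSubgroup p.1 p.2)}

/-! The group is abelian exactly when V and W commute. With n = N + 1, a step is an index in `Fin N`
together with a sign, so the probability is the average, over independent uniform index words a and
b, of `signCommProb a b`, in which only the signs are random. Generators commute unless their
indices differ by one. Superdiagonal entries are additive on the group, and commuting elements v, w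
satisfy v_i w_(i+1) = w_i v_(i+1) (`superdiagonal_mul_comm_of_commute`); this is the only
obstruction to commuting that the proof needs.

For ℓ of order √N or less, V and W commute essentially only when no index of a is adjacent to one of
b. Given a, this has probability (1 - |N(a)|/N)^ℓ, where N(a) is the set of neighbours of a. Since
|N(a)| ≤ 2ℓ, with near equality on average, the limit is exp(-2c²). Conversely, an adjacent pair
whose two indices occur nowhere else violates the obstruction for every choice of signs
(`signCommProb_eq_zero`), and repetitions near an adjacent pair cost only O(ℓ³/N²)
(`pr_crowded_le`).

For larger ℓ, which may far exceed N, the disjoint index pairs (2i, 2i+1) are used. If 2i occurs in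
a and 2i+1 in b, flipping one sign in each word shows that the obstruction for that pair holds with
probability at most 3/4, even given the other such pairs (`signCommProb_le_pow`). Chebyshev's
inequality, applied to each word in turn, makes the number of such pairs tend to infinity. -/

/-! ### Generators, superdiagonal entries and commutation -/

/-- The sign `±1` encoded by a Boolean. -/
def boolSign (s : Bool) : ℤ := if s then 1 else -1

/-- The generator `A_i^{±1}` of `U_{N+1}(ℤ)` with index `i` and the given sign. -/
def signedGenerator {N : ℕ} (x : Fin N × Bool) : unitriangularGroup (N + 1) :=
  if x.2 then elementaryMatrix x.1.castSucc x.1.succ Fin.castSucc_lt_succ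
  else (elementaryMatrix x.1.castSucc x.1.succ Fin.castSucc_lt_succ)⁻¹

theorem signedGenerator_coe {N : ℕ} (x : Fin N × Bool) :
    ((signedGenerator x).1 : Matrix (Fin (N + 1)) (Fin (N + 1)) ℤ) =
      1 + Matrix.single x.1.castSucc x.1.succ (boolSign x.2) := by
  obtain ⟨i, s⟩ := x
  cases s
  · simp only [signedGenerator, boolSign, Bool.false_eq_true, if_false, elementaryMatrix,
      InvMemClass.coe_inv, Matrix.SpecialLinearGroup.transvection_inv,
      Matrix.SpecialLinearGroup.transvection_coe]
  · simp only [signedGenerator, boolSign, if_true, elementaryMatrix,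
      Matrix.SpecialLinearGroup.transvection_coe]

/-- The superdiagonal entry in position `(i, i + 1)`. -/
def superdiagonal {N : ℕ} (i : Fin N) (g : unitriangularGroup (N + 1)) : ℤ :=
  (g.1 : Matrix (Fin (N + 1)) (Fin (N + 1)) ℤ) i.castSucc i.succ

theorem unitriangularGroup_mul_apply {n : ℕ} (g h : unitriangularGroup n) (i j : Fin n) :
    ((g * h).1 : Matrix (Fin n) (Fin n) ℤ) i j =
      ∑ k, (g.1 : Matrix (Fin n) (Fin n) ℤ) i k * (h.1 : Matrix (Fin n) (Fin n) ℤ) k j := by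
  rw [Subgroup.coe_mul, Matrix.SpecialLinearGroup.coe_mul, Matrix.mul_apply]

theorem unitriangularGroup_apply_of_lt {n : ℕ} (g : unitriangularGroup n) {i j : Fin n}
    (h : j < i) : (g.1 : Matrix (Fin n) (Fin n) ℤ) i j = 0 :=
  g.2.1 i j h

theorem unitriangularGroup_apply_self {n : ℕ} (g : unitriangularGroup n) (i : Fin n) :
    (g.1 : Matrix (Fin n) (Fin n) ℤ) i i = 1 :=
  g.2.2 i

/-- By triangularity only the two terms next to the diagonal survive, and there the other factor is
a diagonal 1. -/
theorem superdiagonal_mul {N : ℕ} (i : Fin N) (g h : unitriangularGroup (N + 1)) :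
    superdiagonal i (g * h) = superdiagonal i g + superdiagonal i h := by
  rw [superdiagonal, unitriangularGroup_mul_apply,
    Finset.sum_eq_add i.castSucc i.succ Fin.castSucc_lt_succ.ne,
    unitriangularGroup_apply_self, unitriangularGroup_apply_self, superdiagonal, superdiagonal]
  · ring
  · rintro k - ⟨h1, h2⟩
    rcases lt_or_gt_of_ne h1 with h3 | h3
    · rw [unitriangularGroup_apply_of_lt g h3, zero_mul]
    · rw [unitriangularGroup_apply_of_lt h, mul_zero]
      exact lt_of_le_of_ne (Fin.castSucc_lt_iff_succ_le.1 h3) h2.symm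
  · simp
  · simp

theorem superdiagonal_list_prod {N : ℕ} (i : Fin N) (l : List (unitriangularGroup (N + 1))) :
    superdiagonal i l.prod = (l.map (superdiagonal i)).sum := by
  induction l with
  | nil =>
    simp only [List.prod_nil, List.map_nil, List.sum_nil, superdiagonal, OneMemClass.coe_one,
      Matrix.SpecialLinearGroup.coe_one]
    exact Matrix.one_apply_ne Fin.castSucc_lt_succ.ne
  | cons a l ih => simp [superdiagonal_mul, ih]

theorem superdiagonal_signedGenerator {N : ℕ} (i : Fin N) (x : Fin N × Bool) :
    superdiagonal i (signedGenerator x) = if x.1 = i then boolSign x.2 else 0 := by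
  rw [superdiagonal, signedGenerator_coe, Matrix.add_apply,
    Matrix.one_apply_ne Fin.castSucc_lt_succ.ne, zero_add, Matrix.single_apply]
  simp

/-- The entry of gh two places right of the diagonal is the sum of those of g and h and one product
of superdiagonal entries. In gh = hg the sums cancel and the products remain. -/
theorem superdiagonal_mul_comm_of_commute {N : ℕ} {i j : Fin N} (hij : (j : ℕ) = i + 1)
    {g h : unitriangularGroup (N + 1)} (hgh : Commute g h) :
    superdiagonal i g * superdiagonal j h = superdiagonal i h * superdiagonal j g := by
  have key : ∀ g h : unitriangularGroup (N + 1),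
      ((g * h).1 : Matrix (Fin (N + 1)) (Fin (N + 1)) ℤ) i.castSucc j.succ =
        (g.1 : Matrix (Fin (N + 1)) (Fin (N + 1)) ℤ) i.castSucc j.succ +
          superdiagonal i g * superdiagonal j h +
          (h.1 : Matrix (Fin (N + 1)) (Fin (N + 1)) ℤ) i.castSucc j.succ := by
    intro g h
    have hs : j.castSucc = i.succ := by ext; simp [hij]
    have h01 : i.castSucc < i.succ := Fin.castSucc_lt_succ
    have h12 : i.succ < j.succ := hs ▸ Fin.castSucc_lt_succ
    rw [unitriangularGroup_mul_apply, superdiagonal, superdiagonal, hs,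
      ← Finset.sum_subset (Finset.subset_univ {i.castSucc, i.succ, j.succ}),
      Finset.sum_insert, Finset.sum_insert, Finset.sum_singleton,
      unitriangularGroup_apply_self, unitriangularGroup_apply_self]
    · ring
    · simpa using h12.ne
    · simp [h01.ne, (h01.trans h12).ne]
    · intro k _ hk
      simp only [Finset.mem_insert, Finset.mem_singleton, not_or] at hk
      obtain ⟨h1, h2, h3⟩ := hk
      by_cases hk1 : k < i.castSucc
      · rw [unitriangularGroup_apply_of_lt g hk1, zero_mul]
      · rw [unitriangularGroup_apply_of_lt h, mul_zero]
        simp only [Fin.ext_iff, Fin.lt_def, Fin.val_succ, Fin.val_castSucc] at *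
        omega
  have h1 := key g h
  rw [hgh.eq, key h g] at h1
  linarith

/-- Writing the generators as 1 + X and 1 + Y, both XY and YX vanish, because the column of one
matrix unit never meets the row of the other. -/
theorem commute_signedGenerator {N : ℕ} {x y : Fin N × Bool}
    (h1 : (x.1 : ℕ) + 1 ≠ y.1) (h2 : (y.1 : ℕ) + 1 ≠ x.1) :
    Commute (signedGenerator x) (signedGenerator y) := by
  apply Subtype.ext
  apply Subtype.ext
  rw [Subgroup.coe_mul, Subgroup.coe_mul, Matrix.SpecialLinearGroup.coe_mul,
    Matrix.SpecialLinearGroup.coe_mul, signedGenerator_coe, signedGenerator_coe]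
  have hz : ∀ a b : Fin N × Bool, (a.1 : ℕ) + 1 ≠ b.1 →
      Matrix.single a.1.castSucc a.1.succ (boolSign a.2) *
        Matrix.single b.1.castSucc b.1.succ (boolSign b.2) = 0 := by
    intro a b h
    rw [Matrix.single_mul_single_of_ne]
    simpa [Fin.ext_iff] using h
  simp only [mul_add, add_mul, mul_one, one_mul, hz x y h1, hz y x h2]
  abel

theorem signedGenerator_injective {N : ℕ} :
    Function.Injective (signedGenerator : Fin N × Bool → unitriangularGroup (N + 1)) := by
  intro x y h
  have h1 := superdiagonal_signedGenerator x.1 x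
  rw [h, superdiagonal_signedGenerator] at h1
  obtain ⟨i, s⟩ := x
  obtain ⟨j, t⟩ := y
  revert h1
  by_cases hij : j = i <;> cases s <;> cases t <;> simp [boolSign, hij]

theorem signedGenerator_mem {N : ℕ} (x : Fin N × Bool) :
    signedGenerator x ∈ standardGenerators (N + 1) := by
  refine ⟨x.1.castSucc, x.1.succ, Fin.castSucc_lt_succ, by simp, ?_⟩
  obtain ⟨i, s⟩ := x
  cases s <;> simp [signedGenerator]

/-- A step of the walk is given by an index and a sign. -/
noncomputable def letterEquivStep (N : ℕ) : Fin N × Bool ≃ Step (N + 1) :=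
  Equiv.ofBijective (fun x => ⟨signedGenerator x, signedGenerator_mem x⟩) <| by
    refine ⟨fun x y h => signedGenerator_injective (congrArg Subtype.val h), ?_⟩
    rintro ⟨g, i, j, hij, hj, hg⟩
    obtain ⟨i', rfl⟩ : ∃ i' : Fin N, i = i'.castSucc :=
      ⟨⟨i, by have := j.2; omega⟩, by ext; simp⟩
    obtain rfl : j = i'.succ := by ext; simpa using hj
    rcases hg with rfl | rfl
    · exact ⟨(i', true), Subtype.ext (by simp [signedGenerator])⟩
    · exact ⟨(i', false), Subtype.ext (by simp [signedGenerator])⟩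

/-- The endpoint of the walk whose steps have the indices `a` and the signs `ε`. -/
def letterWalkEnd {N ℓ : ℕ} (a : Fin ℓ → Fin N) (ε : Fin ℓ → Bool) :
    unitriangularGroup (N + 1) :=
  (List.ofFn fun k => signedGenerator (a k, ε k)).prod

theorem superdiagonal_letterWalkEnd {N ℓ : ℕ} (i : Fin N) (a : Fin ℓ → Fin N)
    (ε : Fin ℓ → Bool) :
    superdiagonal i (letterWalkEnd a ε) = ∑ k, if a k = i then boolSign (ε k) else 0 := by
  rw [letterWalkEnd, superdiagonal_list_prod, List.map_ofFn, List.sum_ofFn]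
  simp [superdiagonal_signedGenerator]

/-- The indices of two letters are neighbours, i.e. their generators do not commute. -/
def Adjacent {N : ℕ} (i j : Fin N) : Prop := (i : ℕ) + 1 = j ∨ (j : ℕ) + 1 = i

theorem commute_letterWalkEnd {N ℓ : ℕ} {a b : Fin ℓ → Fin N}
    (h : ∀ k m, ¬ Adjacent (a k) (b m)) (ε δ : Fin ℓ → Bool) :
    Commute (letterWalkEnd a ε) (letterWalkEnd b δ) := by
  refine Commute.list_prod_right _ _ fun x hx => Commute.list_prod_left _ _ fun y hy => ?_
  rw [List.mem_ofFn] at hx hy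
  obtain ⟨m, rfl⟩ := hx
  obtain ⟨k, rfl⟩ := hy
  have := h k m
  rw [Adjacent, not_or] at this
  exact commute_signedGenerator this.1 this.2

theorem isMulCommutative_closure_pair_iff {G : Type*} [Group G] (g h : G) :
    IsMulCommutative (Subgroup.closure {g, h}) ↔ Commute g h := by
  constructor
  · intro H
    have := H.1.comm (⟨g, Subgroup.subset_closure (by simp)⟩ : Subgroup.closure {g, h})
      ⟨h, Subgroup.subset_closure (by simp)⟩
    exact congrArg Subtype.val this
  · intro H
    refine Subgroup.isMulCommutative_closure ?_
    rintro x (rfl | rfl) y (rfl | rfl)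
    · rfl
    · exact H.eq
    · exact H.eq.symm
    · rfl

/-! ### Uniform probability on finite types -/

section UniformProbability

open scoped BigOperators

/-- The probability of `p` under the uniform distribution on a finite type. -/
noncomputable def pr {Ω : Type*} [Fintype Ω] (p : Ω → Prop) : ℝ :=
  𝔼 ω, open Classical in if p ω then (1 : ℝ) else 0

variable {Ω Ω' : Type*} [Fintype Ω] [Fintype Ω'] {p q : Ω → Prop}

theorem pr_eq_card_div (p : Ω → Prop) [DecidablePred p] :
    pr p = ((Finset.univ.filter p).card : ℝ) / Fintype.card Ω := by
  rw [pr, Fintype.expect_eq_sum_div_card, Finset.card_filter]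
  push_cast
  refine congrArg (· / _) (Finset.sum_congr rfl fun ω _ => ?_)
  by_cases h : p ω <;> simp [h]

theorem pr_mono (h : ∀ ω, p ω → q ω) : pr p ≤ pr q := by
  refine Finset.expect_le_expect fun ω _ => ?_
  by_cases h1 : p ω
  · simp [h1, h ω h1]
  · rw [if_neg h1]; positivity

theorem pr_congr (h : ∀ ω, p ω ↔ q ω) : pr p = pr q :=
  congrArg pr (funext fun ω => propext (h ω))

theorem pr_nonneg (p : Ω → Prop) : 0 ≤ pr p :=
  Finset.expect_nonneg fun ω _ => by positivity

theorem pr_le_one (p : Ω → Prop) : pr p ≤ 1 := by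
  classical
  rw [pr_eq_card_div]
  refine div_le_one_of_le₀ ?_ (by positivity)
  exact_mod_cast Finset.card_le_univ _

theorem pr_true [Nonempty Ω] (h : ∀ ω, p ω) : pr p = 1 := by
  simp [pr, h]

theorem pr_not [Nonempty Ω] (p : Ω → Prop) : pr (fun ω => ¬ p ω) = 1 - pr p := by
  rw [eq_sub_iff_add_eq, pr, pr, ← Finset.expect_add_distrib, ← Fintype.expect_one (ι := Ω)]
  refine Finset.expect_congr rfl fun ω _ => ?_
  by_cases h : p ω <;> simp [h]

theorem pr_exists_le {ι : Type*} (s : Finset ι) (r : ι → Ω → Prop) :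
    pr (fun ω => ∃ i ∈ s, r i ω) ≤ ∑ i ∈ s, pr (r i) := by
  simp only [pr]
  rw [← Finset.expect_sum_comm]
  refine Finset.expect_le_expect fun ω _ => ?_
  split_ifs with h
  · obtain ⟨i, hi, hr⟩ := h
    refine le_trans ?_ (Finset.single_le_sum (fun j _ => ?_) hi)
    · simp [hr]
    · positivity
  · exact Finset.sum_nonneg fun j _ => by positivity

theorem pr_equiv (e : Ω' ≃ Ω) (p : Ω → Prop) : pr (fun ω => p (e ω)) = pr p :=
  Fintype.expect_equiv e _ _ fun _ => rfl

theorem pr_prod (p : Ω × Ω' → Prop) : pr p = 𝔼 ω, pr fun ω' => p (ω, ω') := by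
  simp only [pr]
  rw [← Finset.univ_product_univ, Finset.expect_product]

/-- Permutations that preserve `X` and of which one always leads out of `E` bound the conditional
probability of `E` given `X`. -/
theorem pr_and_le_of_perm {ι : Type*} [Fintype ι] [Nonempty ι] (e : ι → Equiv.Perm Ω)
    (X E : Ω → Prop) (hX : ∀ k ω, X ω → X (e k ω)) (hE : ∀ ω, X ω → ∃ k, ¬ E (e k ω)) :
    pr (fun ω => X ω ∧ E ω) ≤ (1 - 1 / (Fintype.card ι : ℝ)) * pr X := by
  -- Every point of X is sent into X \ E by some permutation, and all the preimages of X \ E have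
  -- the same probability, so X is at most |ι| times as likely as X \ E.
  have h1 : pr X ≤ ∑ k : ι, pr fun ω => X (e k ω) ∧ ¬ E (e k ω) := by
    refine le_trans (pr_mono fun ω hω => ?_) (pr_exists_le Finset.univ _)
    obtain ⟨k, hk⟩ := hE ω hω
    exact ⟨k, Finset.mem_univ k, hX k ω hω, hk⟩
  simp only [fun k => pr_equiv (e k) (fun ω => X ω ∧ ¬ E ω), Finset.sum_const, Finset.card_univ,
    nsmul_eq_mul] at h1
  have h2 : pr X = pr (fun ω => X ω ∧ E ω) + pr (fun ω => X ω ∧ ¬ E ω) := by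
    rw [pr, pr, pr, ← Finset.expect_add_distrib]
    refine Finset.expect_congr rfl fun ω _ => ?_
    by_cases h : X ω <;> by_cases h' : E ω <;> simp [h, h']
  have hc : (0 : ℝ) < Fintype.card ι := by exact_mod_cast Fintype.card_pos
  have h3 : pr X / Fintype.card ι ≤ pr (fun ω => X ω ∧ ¬ E ω) := by
    rw [div_le_iff₀ hc]; linarith
  have h4 : (1 - 1 / (Fintype.card ι : ℝ)) * pr X = pr X - pr X / Fintype.card ι := by ring
  linarith

variable {α : Type*} [Fintype α] {ℓ : ℕ}

theorem pr_forall_mem (A : Fin ℓ → Finset α) :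
    pr (fun a : Fin ℓ → α => ∀ k, a k ∈ A k) = ∏ k, ((A k).card : ℝ) / Fintype.card α := by
  classical
  rw [pr_eq_card_div, Finset.prod_div_distrib, ← Nat.cast_prod, ← Fintype.card_piFinset]
  simp only [Finset.prod_const, Finset.card_univ, Fintype.card_fin, Fintype.card_fun,
    Nat.cast_pow]
  congr 3
  ext a
  simp

theorem pr_forall_notMem [Nonempty α] (A : Finset α) :
    pr (fun a : Fin ℓ → α => ∀ k, a k ∉ A) = (1 - (A.card : ℝ) / Fintype.card α) ^ ℓ := by
  classical
  have h := pr_forall_mem (ℓ := ℓ) fun _ => Aᶜ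
  simp only [Finset.mem_compl, Finset.prod_const, Finset.card_univ, Fintype.card_fin] at h
  rw [h, Finset.card_compl, Nat.cast_sub (Finset.card_le_univ A), sub_div, div_self]
  exact_mod_cast Fintype.card_ne_zero

theorem pr_mem_and_mem [Nonempty α] {k k' : Fin ℓ} (hk : k ≠ k') (A B : Finset α) :
    pr (fun a : Fin ℓ → α => a k ∈ A ∧ a k' ∈ B) =
      (A.card : ℝ) * B.card / (Fintype.card α : ℝ) ^ 2 := by
  classical
  have hc : (Fintype.card α : ℝ) ≠ 0 := by exact_mod_cast Fintype.card_ne_zero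
  have h := pr_forall_mem (ℓ := ℓ) fun i => if i = k then A else if i = k' then B else Finset.univ
  rw [Finset.prod_eq_mul k k' hk, if_pos rfl, if_neg hk.symm, if_pos rfl] at h
  · rw [div_mul_div_comm, ← sq] at h
    rw [← h]
    refine pr_congr fun a => ⟨fun ⟨h1, h2⟩ i => ?_, fun h => ⟨?_, ?_⟩⟩
    · split_ifs with h3 h4
      · exact h3 ▸ h1
      · exact h4 ▸ h2
      · exact Finset.mem_univ _
    · simpa using h k
    · simpa [hk.symm] using h k'
  · rintro i - ⟨h1, h2⟩
    rw [if_neg h1, if_neg h2, Finset.card_univ, div_self hc]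
  · simp
  · simp

end UniformProbability

/-! ### From the law of the walks to averages over indices and signs -/

instance stepMeasurableSingletonClass (n : ℕ) : MeasurableSingletonClass (Step n) := ⟨fun _ => trivial⟩

noncomputable instance stepFintype (N : ℕ) : Fintype (Step (N + 1)) :=
  Fintype.ofEquiv _ (letterEquivStep N)

theorem wordLaw_real_singleton (N ℓ : ℕ) (v : Fin ℓ → Step (N + 1)) :
    (wordLaw (N + 1) ℓ).real {v} = 1 / (Fintype.card (Fin ℓ → Step (N + 1)) : ℝ) := by
  rw [wordLaw, ← uniformOn_pi, Set.pi_univ, measureReal_def, uniformOn_univ]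
  simp

open scoped Classical in
theorem probSubgroup_eq_pr (N ℓ : ℕ) (P : Subgroup (unitriangularGroup (N + 1)) → Prop) :
    probSubgroup (N + 1) ℓ P =
      pr fun v : (Fin ℓ → Step (N + 1)) × (Fin ℓ → Step (N + 1)) => P (walkSubgroup v.1 v.2) := by
  have hfin : IsFiniteMeasure (wordLaw (N + 1) ℓ) := by
    rw [wordLaw, ← uniformOn_pi]; infer_instance
  rw [pr_eq_card_div, probSubgroup]
  have h : {p : (Fin ℓ → Step (N + 1)) × (Fin ℓ → Step (N + 1)) | P (walkSubgroup p.1 p.2)} =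
    (Finset.univ.filter fun v : (Fin ℓ → Step (N + 1)) × (Fin ℓ → Step (N + 1)) =>
      P (walkSubgroup v.1 v.2) : Finset _) := by ext; simp
  rw [h, ← sum_measureReal_singleton]
  have h2 : ∀ v : (Fin ℓ → Step (N + 1)) × (Fin ℓ → Step (N + 1)),
      ((wordLaw (N + 1) ℓ).prod (wordLaw (N + 1) ℓ)).real {v} =
        1 / (Fintype.card ((Fin ℓ → Step (N + 1)) × (Fin ℓ → Step (N + 1))) : ℝ) := by
    rintro ⟨v, w⟩
    rw [← Set.singleton_prod_singleton, measureReal_prod_prod, wordLaw_real_singleton,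
      wordLaw_real_singleton, Fintype.card_prod, Nat.cast_mul, div_mul_div_comm, one_mul]
  simp only [h2, Finset.sum_const, nsmul_eq_mul]
  ring

/-- The probability, over the signs of the letters, that the walks with indices `a` and `b`
have commuting endpoints. -/
noncomputable def signCommProb {N ℓ : ℕ} (a b : Fin ℓ → Fin N) : ℝ :=
  pr fun s : (Fin ℓ → Bool) × (Fin ℓ → Bool) =>
    Commute (letterWalkEnd a s.1) (letterWalkEnd b s.2)

-- Uniform steps amount to independent uniform indices and signs; the signs are averaged first, with
-- the indices held fixed.
open scoped BigOperators in
theorem probSubgroup_isMulCommutative (N ℓ : ℕ) :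
    (probSubgroup (N + 1) ℓ fun G => IsMulCommutative G) =
      𝔼 a : Fin ℓ → Fin N, 𝔼 b : Fin ℓ → Fin N, signCommProb a b := by
  let f : (Fin ℓ → Fin N) × (Fin ℓ → Bool) ≃ (Fin ℓ → Step (N + 1)) :=
    (Equiv.arrowProdEquivProdArrow (Fin ℓ) (fun _ => Fin N) (fun _ => Bool)).symm.trans
      (Equiv.arrowCongr (Equiv.refl _) (letterEquivStep N))
  rw [probSubgroup_eq_pr, ← pr_equiv ((Equiv.prodProdProdComm _ _ _ _).trans (f.prodCongr f)),
    pr_prod, ← Finset.univ_product_univ, Finset.expect_product]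
  refine Finset.expect_congr rfl fun a _ => Finset.expect_congr rfl fun b _ =>
    pr_congr fun s => ?_
  exact isMulCommutative_closure_pair_iff _ _

theorem probSubgroup_not_isMulCommutative {N : ℕ} (hN : 1 ≤ N) (ℓ : ℕ) :
    (probSubgroup (N + 1) ℓ fun G => ¬ IsMulCommutative G) =
      1 - probSubgroup (N + 1) ℓ fun G => IsMulCommutative G := by
  have : Nonempty (Step (N + 1)) := ⟨letterEquivStep N (⟨0, hN⟩, true)⟩
  rw [probSubgroup_eq_pr, probSubgroup_eq_pr, pr_not]

/-! ### Few letters: bounds that are sharp at ℓ of order √N -/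

section Sparse

open scoped BigOperators Classical

variable {N ℓ : ℕ}

theorem Adjacent.symm {i j : Fin N} (h : Adjacent i j) : Adjacent j i := Or.symm h

/-- The indices adjacent to `i`. -/
noncomputable def neighbours (i : Fin N) : Finset (Fin N) := Finset.univ.filter (Adjacent i)

theorem mem_neighbours {i j : Fin N} : j ∈ neighbours i ↔ Adjacent i j := by simp [neighbours]

theorem card_neighbours_le (i : Fin N) : (neighbours i).card ≤ 2 := by
  rw [← Finset.card_map Fin.valEmbedding]
  refine (Finset.card_le_card (t := {(i : ℕ) + 1, (i : ℕ) - 1}) fun x hx => ?_).trans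
    Finset.card_le_two
  simp only [Finset.mem_map, mem_neighbours, Fin.valEmbedding_apply, Adjacent] at hx
  simp only [Finset.mem_insert, Finset.mem_singleton]
  omega

theorem two_le_card_neighbours {i : Fin N} (h0 : 0 < (i : ℕ)) (h1 : (i : ℕ) + 1 < N) :
    2 ≤ (neighbours i).card := by
  have : ({⟨i + 1, h1⟩, ⟨i - 1, by omega⟩} : Finset (Fin N)) ⊆ neighbours i := by
    intro x hx
    simp only [Finset.mem_insert, Finset.mem_singleton] at hx
    rw [mem_neighbours, Adjacent]
    rcases hx with rfl | rfl
    · exact Or.inl rfl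
    · exact Or.inr (Nat.sub_add_cancel h0)
  refine le_trans ?_ (Finset.card_le_card this)
  rw [Finset.card_pair]
  simp only [ne_eq, Fin.mk.injEq]
  omega

/-- The indices adjacent to some letter of the word `a`. -/
noncomputable def wordNeighbours (a : Fin ℓ → Fin N) : Finset (Fin N) :=
  Finset.univ.biUnion fun k => neighbours (a k)

theorem mem_wordNeighbours {a : Fin ℓ → Fin N} {j : Fin N} :
    j ∈ wordNeighbours a ↔ ∃ k, Adjacent (a k) j := by
  simp [wordNeighbours, mem_neighbours]

theorem card_wordNeighbours_le (a : Fin ℓ → Fin N) : (wordNeighbours a).card ≤ 2 * ℓ := by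
  refine (Finset.card_biUnion_le_card_mul _ _ 2 fun k _ => card_neighbours_le _).trans ?_
  simp [mul_comm]

theorem pr_not_adjacent (hN : 1 ≤ N) (a : Fin ℓ → Fin N) :
    pr (fun b : Fin ℓ → Fin N => ∀ k m, ¬ Adjacent (a k) (b m)) =
      (1 - ((wordNeighbours a).card : ℝ) / N) ^ ℓ := by
  have : Nonempty (Fin N) := ⟨⟨0, hN⟩⟩
  have h := pr_forall_notMem (ℓ := ℓ) (wordNeighbours a)
  rw [Fintype.card_fin] at h
  rw [← h]
  refine pr_congr fun b => ?_
  simp only [mem_wordNeighbours, not_exists]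
  exact forall_comm

theorem signCommProb_of_not_adjacent {a b : Fin ℓ → Fin N}
    (h : ∀ k m, ¬ Adjacent (a k) (b m)) : signCommProb a b = 1 :=
  pr_true fun s => commute_letterWalkEnd h s.1 s.2

theorem le_expect_signCommProb (hN : 1 ≤ N) (hℓ : 2 * ℓ ≤ N) :
    (1 - 2 * (ℓ : ℝ) / N) ^ ℓ ≤
      𝔼 a : Fin ℓ → Fin N, 𝔼 b : Fin ℓ → Fin N, signCommProb a b := by
  have : Nonempty (Fin N) := ⟨⟨0, hN⟩⟩
  have hN' : (0 : ℝ) < N := by exact_mod_cast hN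
  refine Finset.le_expect Finset.univ_nonempty fun a _ => ?_
  calc (1 - 2 * (ℓ : ℝ) / N) ^ ℓ ≤ (1 - ((wordNeighbours a).card : ℝ) / N) ^ ℓ := by
        have h1 : 2 * (ℓ : ℝ) ≤ N := by exact_mod_cast hℓ
        have h2 : ((wordNeighbours a).card : ℝ) ≤ 2 * ℓ := by
          exact_mod_cast card_wordNeighbours_le a
        have h3 : 2 * (ℓ : ℝ) / N ≤ 1 := (div_le_one hN').2 h1
        gcongr
    _ = pr (fun b : Fin ℓ → Fin N => ∀ k m, ¬ Adjacent (a k) (b m)) :=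
        (pr_not_adjacent hN a).symm
    _ ≤ _ := by
        refine Finset.expect_le_expect fun b _ => ?_
        split_ifs with h
        · exact (signCommProb_of_not_adjacent h).ge
        · exact pr_nonneg _

/-- Bonferroni-type truncation at second order, used to bound from below the chance that a given
index is a neighbour of the word. -/
theorem one_sub_pow_le {x : ℝ} (h0 : 0 ≤ x) (h1 : x ≤ 1) (n : ℕ) :
    (1 - x) ^ n ≤ 1 - n * x + (n * x) ^ 2 / 2 := by
  induction n with
  | zero => simp
  | succ n ih =>
    have h2 : (1 - x) ^ (n + 1) ≤ (1 - x) * (1 - n * x + (n * x) ^ 2 / 2) := by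
      rw [pow_succ']
      exact mul_le_mul_of_nonneg_left ih (by linarith)
    refine h2.trans ?_
    have h3 : 0 ≤ x * (n * x) ^ 2 := by positivity
    push_cast
    nlinarith [sq_nonneg x]

/-- The function exp(-x) is 1-Lipschitz on [0, ∞). This linearises the dependence on |N(a)|, so that
its mean suffices and no variance is needed. -/
theorem exp_neg_le_add {x y : ℝ} (h0 : 0 ≤ x) (hxy : x ≤ y) :
    Real.exp (-x) ≤ Real.exp (-y) + (y - x) := by
  have h1 : Real.exp (-y) = Real.exp (-x) * Real.exp (x - y) := by
    rw [← Real.exp_add]; ring_nf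
  have h2 := Real.add_one_le_exp (x - y)
  have h3 : Real.exp (-x) ≤ 1 := Real.exp_le_one_iff.2 (by linarith)
  have h4 := Real.exp_pos (-x)
  nlinarith

/-- Each of the at least N - 2 interior indices has two neighbours, hence lies in N(a) with
probability 1 - (1 - 2/N)^ℓ, about 2ℓ/N. The losses come from the two ends and from the second-order
term. -/
theorem le_expect_card_wordNeighbours (hN : 2 ≤ N) :
    2 * (ℓ : ℝ) - 4 * ℓ / N - 2 * ℓ ^ 2 / N ≤
      𝔼 a : Fin ℓ → Fin N, ((wordNeighbours a).card : ℝ) := by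
  have : Nonempty (Fin N) := ⟨⟨0, by omega⟩⟩
  have hN' : (2 : ℝ) ≤ N := by exact_mod_cast hN
  have hN0 : (0 : ℝ) < N := by linarith
  have h1 : (𝔼 a : Fin ℓ → Fin N, ((wordNeighbours a).card : ℝ)) =
      ∑ j : Fin N, (1 - (1 - ((neighbours j).card : ℝ) / N) ^ ℓ) := by
    have h2 : ∀ a : Fin ℓ → Fin N, ((wordNeighbours a).card : ℝ) =
        ∑ j : Fin N, if j ∈ wordNeighbours a then (1 : ℝ) else 0 := by
      intro a; simp
    simp only [h2]
    rw [Finset.expect_sum_comm]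
    refine Finset.sum_congr rfl fun j _ => ?_
    -- By symmetry of adjacency, j is missed by N(a) exactly when a avoids the neighbours of j.
    have h := pr_forall_notMem (ℓ := ℓ) (neighbours j)
    rw [Fintype.card_fin] at h
    rw [← h, ← pr_not, pr]
    refine Finset.expect_congr rfl fun a _ => ?_
    congr 1
    simp only [mem_wordNeighbours, mem_neighbours, not_forall, not_not, eq_iff_iff]
    exact exists_congr fun k => ⟨Adjacent.symm, Adjacent.symm⟩
  let S : Finset (Fin N) := Finset.univ.filter fun j => 0 < (j : ℕ) ∧ (j : ℕ) + 1 < N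
  have hS : N - 2 ≤ S.card := by
    have : Sᶜ ⊆ {⟨0, by omega⟩, ⟨N - 1, by omega⟩} := by
      intro j hj
      simp only [S, Finset.mem_compl, Finset.mem_filter, Finset.mem_univ, true_and] at hj
      simp only [Finset.mem_insert, Finset.mem_singleton, Fin.ext_iff]
      omega
    have h3 := (Finset.card_le_card this).trans Finset.card_le_two
    rw [Finset.card_compl, Fintype.card_fin] at h3
    omega
  have hS' : (N : ℝ) - 2 ≤ S.card := by
    have : ((N - 2 : ℕ) : ℝ) ≤ S.card := by exact_mod_cast hS
    rwa [Nat.cast_sub hN] at this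
  have hdeg : ∀ j : Fin N, ((neighbours j).card : ℝ) ≤ 2 := fun j => by
    exact_mod_cast card_neighbours_le j
  have hle1 : ∀ j : Fin N, 0 ≤ 1 - ((neighbours j).card : ℝ) / N := fun j => by
    rw [sub_nonneg, div_le_one hN0]
    linarith [hdeg j]
  have h4 : (S.card : ℝ) * (1 - (1 - 2 / (N : ℝ)) ^ ℓ) ≤
      ∑ j : Fin N, (1 - (1 - ((neighbours j).card : ℝ) / N) ^ ℓ) := by
    rw [← nsmul_eq_mul, ← Finset.sum_const]
    refine (Finset.sum_le_sum fun j hj => ?_).trans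
      (Finset.sum_le_sum_of_subset_of_nonneg (Finset.subset_univ S) fun j _ _ => ?_)
    · have hj' := (Finset.mem_filter.1 hj).2
      have h5 : (neighbours j).card = 2 :=
        le_antisymm (card_neighbours_le j) (two_le_card_neighbours hj'.1 hj'.2)
      rw [h5]; norm_num
    · rw [sub_nonneg]
      refine pow_le_one₀ (hle1 j) ?_
      rw [sub_le_self_iff]; positivity
  have hx1 : 2 / (N : ℝ) ≤ 1 := (div_le_one hN0).2 hN'
  have h6 := one_sub_pow_le (x := 2 / (N : ℝ)) (by positivity) hx1 ℓ
  have h7 : (1 - 2 / (N : ℝ)) ^ ℓ ≤ 1 := by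
    refine pow_le_one₀ (by linarith) ?_
    rw [sub_le_self_iff]; positivity
  have h8 : ((N : ℝ) - 2) * (1 - (1 - 2 / (N : ℝ)) ^ ℓ) ≤
      (S.card : ℝ) * (1 - (1 - 2 / (N : ℝ)) ^ ℓ) :=
    mul_le_mul_of_nonneg_right hS' (by linarith)
  have h9 : ((N : ℝ) - 2) * (ℓ * (2 / (N : ℝ)) - (ℓ * (2 / (N : ℝ))) ^ 2 / 2) ≤
      ((N : ℝ) - 2) * (1 - (1 - 2 / (N : ℝ)) ^ ℓ) :=
    mul_le_mul_of_nonneg_left (by linarith) (by linarith)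
  have h10 : ((N : ℝ) - 2) * (ℓ * (2 / (N : ℝ)) - (ℓ * (2 / (N : ℝ))) ^ 2 / 2) =
      2 * (ℓ : ℝ) - 4 * ℓ / N - 2 * ℓ ^ 2 / N + 4 * ℓ ^ 2 / N ^ 2 := by
    field_simp; ring
  have h11 : (0 : ℝ) ≤ 4 * (ℓ : ℝ) ^ 2 / N ^ 2 := by positivity
  rw [h1]
  linarith

/-- The exponent ℓ|N(a)|/N never exceeds 2ℓ²/N, so the error is at most its expected shortfall, ℓ/N
times (4ℓ/N + 2ℓ²/N). -/
theorem expect_pr_not_adjacent_le (hN : 2 ≤ N) :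
    𝔼 a : Fin ℓ → Fin N, pr (fun b : Fin ℓ → Fin N => ∀ k m, ¬ Adjacent (a k) (b m)) ≤
      Real.exp (-(2 * (ℓ : ℝ) ^ 2 / N)) + 4 * (ℓ : ℝ) ^ 2 / N ^ 2 + 2 * (ℓ : ℝ) ^ 3 / N ^ 2 := by
  have : Nonempty (Fin N) := ⟨⟨0, by omega⟩⟩
  have hN0 : (0 : ℝ) < N := by exact_mod_cast (by omega : 0 < N)
  calc 𝔼 a : Fin ℓ → Fin N, pr (fun b : Fin ℓ → Fin N => ∀ k m, ¬ Adjacent (a k) (b m))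
      ≤ 𝔼 a : Fin ℓ → Fin N, (Real.exp (-(2 * (ℓ : ℝ) ^ 2 / N)) + 2 * (ℓ : ℝ) ^ 2 / N -
          ((ℓ : ℝ) / N) * ((wordNeighbours a).card : ℝ)) := by
        refine Finset.expect_le_expect fun a _ => ?_
        have hc : ((wordNeighbours a).card : ℝ) ≤ 2 * ℓ := by
          exact_mod_cast card_wordNeighbours_le a
        have hcN : ((wordNeighbours a).card : ℝ) ≤ N := by
          exact_mod_cast (Finset.card_le_univ _).trans_eq (Fintype.card_fin N)
        have hxy : ((ℓ : ℝ) / N) * ((wordNeighbours a).card : ℝ) ≤ 2 * (ℓ : ℝ) ^ 2 / N := by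
          rw [div_mul_eq_mul_div]
          refine div_le_div_of_nonneg_right ?_ hN0.le
          have := mul_le_mul_of_nonneg_left hc (Nat.cast_nonneg (α := ℝ) ℓ)
          linarith
        rw [pr_not_adjacent (by omega)]
        calc (1 - ((wordNeighbours a).card : ℝ) / N) ^ ℓ
            ≤ Real.exp (-(((wordNeighbours a).card : ℝ) / N)) ^ ℓ := by
              have : ((wordNeighbours a).card : ℝ) / N ≤ 1 := (div_le_one hN0).2 hcN
              exact pow_le_pow_left₀ (by linarith) (Real.one_sub_le_exp_neg _) _
          _ = Real.exp (-(((ℓ : ℝ) / N) * ((wordNeighbours a).card : ℝ))) := by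
              rw [← Real.exp_nat_mul]; ring_nf
          _ ≤ _ := by
              have := exp_neg_le_add (by positivity) hxy
              linarith
    _ = Real.exp (-(2 * (ℓ : ℝ) ^ 2 / N)) + 2 * (ℓ : ℝ) ^ 2 / N -
          ((ℓ : ℝ) / N) * 𝔼 a : Fin ℓ → Fin N, ((wordNeighbours a).card : ℝ) := by
        rw [Finset.expect_sub_distrib, Fintype.expect_const, Finset.mul_expect]
    _ ≤ Real.exp (-(2 * (ℓ : ℝ) ^ 2 / N)) + 2 * (ℓ : ℝ) ^ 2 / N -
          ((ℓ : ℝ) / N) * (2 * (ℓ : ℝ) - 4 * ℓ / N - 2 * ℓ ^ 2 / N) := by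
        gcongr
        exact le_expect_card_wordNeighbours hN
    _ = _ := by field_simp; ring

/-- Some letter of `a` is adjacent to a letter of `b`, and another letter of `a` has the same
index as one of these two. -/
def Crowded (a b : Fin ℓ → Fin N) : Prop :=
  ∃ k k' m, k ≠ k' ∧ Adjacent (b m) (a k) ∧ (a k' = a k ∨ a k' = b m)

/-- Union bound over ℓ³ triples of positions and at most 2 neighbours x of `b m`: prescribing `a k =
x` and two possible values of `a k'` costs at most 2/N². -/
theorem pr_crowded_le (hN : 1 ≤ N) (b : Fin ℓ → Fin N) :
    pr (fun a : Fin ℓ → Fin N => Crowded a b) ≤ 4 * (ℓ : ℝ) ^ 3 / N ^ 2 := by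
  have : Nonempty (Fin N) := ⟨⟨0, hN⟩⟩
  have hN0 : (0 : ℝ) < N := by exact_mod_cast hN
  calc pr (fun a : Fin ℓ → Fin N => Crowded a b)
      ≤ pr (fun a : Fin ℓ → Fin N => ∃ k ∈ (Finset.univ : Finset (Fin ℓ)),
          ∃ k' ∈ (Finset.univ : Finset (Fin ℓ)), ∃ m ∈ (Finset.univ : Finset (Fin ℓ)),
            ∃ x ∈ neighbours (b m), k ≠ k' ∧
              (a k ∈ ({x} : Finset (Fin N)) ∧ a k' ∈ ({x, b m} : Finset (Fin N)))) := by
        refine pr_mono fun a => ?_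
        rintro ⟨k, k', m, hk, h1, h2⟩
        exact ⟨k, Finset.mem_univ _, k', Finset.mem_univ _, m, Finset.mem_univ _, a k,
          mem_neighbours.2 h1, hk, by simp, by simpa using h2⟩
    _ ≤ ∑ _k : Fin ℓ, ∑ _k' : Fin ℓ, ∑ m : Fin ℓ, ∑ _x ∈ neighbours (b m), (2 / (N : ℝ) ^ 2) := by
        refine (pr_exists_le _ _).trans (Finset.sum_le_sum fun k _ => ?_)
        refine (pr_exists_le _ _).trans (Finset.sum_le_sum fun k' _ => ?_)
        refine (pr_exists_le _ _).trans (Finset.sum_le_sum fun m _ => ?_)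
        refine (pr_exists_le _ _).trans (Finset.sum_le_sum fun x _ => ?_)
        by_cases hk : k = k'
        · rw [pr_eq_card_div]
          simp only [hk, ne_eq, not_true_eq_false, false_and, Finset.filter_false,
            Finset.card_empty, Nat.cast_zero, zero_div]
          positivity
        · refine (pr_mono fun a h => h.2).trans ?_
          rw [pr_mem_and_mem hk, Finset.card_singleton, Fintype.card_fin, Nat.cast_one, one_mul]
          gcongr
          exact_mod_cast Finset.card_le_two
    _ ≤ ∑ _k : Fin ℓ, ∑ _k' : Fin ℓ, ∑ m : Fin ℓ, (4 / (N : ℝ) ^ 2) := by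
        refine Finset.sum_le_sum fun k _ => Finset.sum_le_sum fun k' _ =>
          Finset.sum_le_sum fun m _ => ?_
        rw [Finset.sum_const, nsmul_eq_mul, mul_div_assoc']
        gcongr
        have : ((neighbours (b m)).card : ℝ) ≤ 2 := by exact_mod_cast card_neighbours_le (b m)
        linarith
    _ = _ := by
        simp only [Finset.sum_const, Finset.card_univ, Fintype.card_fin, nsmul_eq_mul]
        ring

theorem boolSign_ne_zero (s : Bool) : boolSign s ≠ 0 := by cases s <;> simp [boolSign]

/-- Without crowding, `a k` occurs once in a and never in b, and `b m` once in b and never in a. One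
side of the commutation identity is then ±1 and the other is 0, whatever the signs. -/
theorem signCommProb_eq_zero {a b : Fin ℓ → Fin N} {k m : Fin ℓ} (h : Adjacent (a k) (b m))
    (h1 : ¬ Crowded a b) (h2 : ¬ Crowded b a) : signCommProb a b = 0 := by
  have hak : ∀ k', a k' = a k ↔ k' = k := fun k' => by
    refine ⟨fun h' => ?_, fun h' => by rw [h']⟩
    by_contra hk
    exact h1 ⟨k, k', m, Ne.symm hk, h.symm, Or.inl h'⟩
  have hab : ∀ k', a k' ≠ b m := fun k' h' => by
    by_cases hk : k = k'
    · subst hk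
      rw [h'] at h
      unfold Adjacent at h
      omega
    · exact h1 ⟨k, k', m, hk, h.symm, Or.inr h'⟩
  have hbm : ∀ m', b m' = b m ↔ m' = m := fun m' => by
    refine ⟨fun h' => ?_, fun h' => by rw [h']⟩
    by_contra hk
    exact h2 ⟨m, m', k, Ne.symm hk, h, Or.inl h'⟩
  have hba : ∀ m', b m' ≠ a k := fun m' h' => by
    by_cases hk : m = m'
    · subst hk
      rw [h'] at h
      unfold Adjacent at h
      omega
    · exact h2 ⟨m, m', k, hk, h, Or.inr h'⟩
  have key : ∀ s : (Fin ℓ → Bool) × (Fin ℓ → Bool),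
      ¬ Commute (letterWalkEnd a s.1) (letterWalkEnd b s.2) := by
    intro s hs
    have e1 : superdiagonal (a k) (letterWalkEnd a s.1) = boolSign (s.1 k) := by
      simp [superdiagonal_letterWalkEnd, hak]
    have e2 : superdiagonal (b m) (letterWalkEnd a s.1) = 0 := by
      simp [superdiagonal_letterWalkEnd, hab]
    have e3 : superdiagonal (b m) (letterWalkEnd b s.2) = boolSign (s.2 m) := by
      simp [superdiagonal_letterWalkEnd, hbm]
    have e4 : superdiagonal (a k) (letterWalkEnd b s.2) = 0 := by
      simp [superdiagonal_letterWalkEnd, hba]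
    have hne := mul_ne_zero (boolSign_ne_zero (s.1 k)) (boolSign_ne_zero (s.2 m))
    rcases h with h | h
    · have := superdiagonal_mul_comm_of_commute h.symm hs
      rw [e1, e2, e3, e4, mul_zero] at this
      exact hne this
    · have := superdiagonal_mul_comm_of_commute h.symm hs
      rw [e1, e2, e3, e4, mul_zero, mul_comm] at this
      exact hne this.symm
  rw [signCommProb, pr_eq_card_div, Finset.filter_false_of_mem fun s _ => key s]
  simp

/-- Commuting requires that no pair is adjacent or that one of the words is crowded relative to the
other; the cubic constant is 2 + 4 + 4. -/
theorem expect_signCommProb_le (hN : 2 ≤ N) :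
    𝔼 a : Fin ℓ → Fin N, 𝔼 b : Fin ℓ → Fin N, signCommProb a b ≤
      Real.exp (-(2 * (ℓ : ℝ) ^ 2 / N)) + 4 * (ℓ : ℝ) ^ 2 / N ^ 2 + 10 * (ℓ : ℝ) ^ 3 / N ^ 2 := by
  have : Nonempty (Fin N) := ⟨⟨0, by omega⟩⟩
  have hpt : ∀ a b : Fin ℓ → Fin N, signCommProb a b ≤
      (if ∀ k m, ¬ Adjacent (a k) (b m) then (1 : ℝ) else 0) + (if Crowded a b then (1 : ℝ) else 0)
        + (if Crowded b a then (1 : ℝ) else 0) := by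
    intro a b
    have hle : signCommProb a b ≤ 1 := pr_le_one _
    by_cases h0 : ∀ k m, ¬ Adjacent (a k) (b m)
    · rw [if_pos h0]
      split_ifs <;> linarith
    · by_cases h1 : Crowded a b
      · rw [if_pos h1]
        split_ifs <;> linarith
      · by_cases h2 : Crowded b a
        · rw [if_pos h2]
          split_ifs
          linarith
        · push Not at h0
          obtain ⟨k, m, h⟩ := h0
          rw [signCommProb_eq_zero h h1 h2]
          positivity
  have h1 := expect_pr_not_adjacent_le (ℓ := ℓ) hN
  have h2 : 𝔼 a : Fin ℓ → Fin N, 𝔼 b : Fin ℓ → Fin N, (if Crowded a b then (1 : ℝ) else 0) ≤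
      4 * (ℓ : ℝ) ^ 3 / N ^ 2 := by
    rw [Finset.expect_comm]
    exact Finset.expect_le Finset.univ_nonempty fun b _ => pr_crowded_le (by omega) b
  have h3 : 𝔼 a : Fin ℓ → Fin N, 𝔼 b : Fin ℓ → Fin N, (if Crowded b a then (1 : ℝ) else 0) ≤
      4 * (ℓ : ℝ) ^ 3 / N ^ 2 :=
    Finset.expect_le Finset.univ_nonempty fun a _ => pr_crowded_le (by omega) a
  have h4 : 𝔼 a : Fin ℓ → Fin N, 𝔼 b : Fin ℓ → Fin N, signCommProb a b ≤
      𝔼 a : Fin ℓ → Fin N, 𝔼 b : Fin ℓ → Fin N,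
      ((if ∀ k m, ¬ Adjacent (a k) (b m) then (1 : ℝ) else 0) +
        (if Crowded a b then (1 : ℝ) else 0) + (if Crowded b a then (1 : ℝ) else 0)) :=
    Finset.expect_le_expect fun a _ => Finset.expect_le_expect fun b _ => hpt a b
  simp only [Finset.expect_add_distrib] at h4
  have h1' : (𝔼 a : Fin ℓ → Fin N, 𝔼 b : Fin ℓ → Fin N,
      if ∀ k m, ¬ Adjacent (a k) (b m) then (1 : ℝ) else 0) =
      𝔼 a : Fin ℓ → Fin N, pr fun b : Fin ℓ → Fin N => ∀ k m, ¬ Adjacent (a k) (b m) := by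
    simp only [pr]
    congr!
  have h5 : 10 * (ℓ : ℝ) ^ 3 / N ^ 2 = 2 * (ℓ : ℝ) ^ 3 / N ^ 2 + 4 * (ℓ : ℝ) ^ 3 / N ^ 2 +
    4 * (ℓ : ℝ) ^ 3 / N ^ 2 := by ring
  linarith

end Sparse

/-! ### Many letters: sign flips on disjoint pairs of indices -/

section SignFlips

variable {N ℓ : ℕ}

/-- Flip the sign in position `p`, provided that `c` is true. -/
def signFlip (p : Fin ℓ) (c : Bool) : Equiv.Perm (Fin ℓ → Bool) :=
  Function.Involutive.toPerm (fun ε k => if k = p then xor (ε k) c else ε k) <| by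
    intro ε
    funext k
    by_cases h : k = p <;> simp [h]

theorem signFlip_apply (p : Fin ℓ) (c : Bool) (ε : Fin ℓ → Bool) (k : Fin ℓ) :
    signFlip p c ε k = if k = p then xor (ε k) c else ε k := rfl

theorem superdiagonal_signFlip_of_ne {a : Fin ℓ → Fin N} {i : Fin N} {p : Fin ℓ} (h : a p ≠ i)
    (c : Bool) (ε : Fin ℓ → Bool) :
    superdiagonal i (letterWalkEnd a (signFlip p c ε)) =
      superdiagonal i (letterWalkEnd a ε) := by
  rw [superdiagonal_letterWalkEnd, superdiagonal_letterWalkEnd]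
  refine Finset.sum_congr rfl fun k _ => ?_
  by_cases hk : k = p
  · rw [hk, if_neg h, if_neg h]
  · rw [signFlip_apply, if_neg hk]

theorem signFlip_false (p : Fin ℓ) (ε : Fin ℓ → Bool) : signFlip p false ε = ε := by
  funext k
  simp [signFlip_apply]

theorem superdiagonal_signFlip_ne {a : Fin ℓ → Fin N} {i : Fin N} {p : Fin ℓ} (h : a p = i)
    (ε : Fin ℓ → Bool) :
    superdiagonal i (letterWalkEnd a (signFlip p true ε)) ≠
      superdiagonal i (letterWalkEnd a ε) := by
  rw [superdiagonal_letterWalkEnd, superdiagonal_letterWalkEnd,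
    ← Finset.add_sum_erase _ _ (Finset.mem_univ p),
    ← Finset.add_sum_erase Finset.univ _ (Finset.mem_univ p), if_pos h, if_pos h]
  have h1 : ∀ k ∈ Finset.univ.erase p, (if a k = i then boolSign (signFlip p true ε k) else 0) =
      if a k = i then boolSign (ε k) else 0 := by
    intro k hk
    rw [signFlip_apply, if_neg (Finset.ne_of_mem_erase hk)]
  rw [Finset.sum_congr rfl h1, Ne, add_left_inj, signFlip_apply, if_pos rfl]
  cases ε p <;> simp [boolSign]

/-- The even index `2 i`. -/
def evenIndex (i : Fin (N / 2)) : Fin N := ⟨2 * i, by omega⟩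

/-- The odd index `2 i + 1`. -/
def oddIndex (i : Fin (N / 2)) : Fin N := ⟨2 * i + 1, by omega⟩

theorem evenIndex_injective : Function.Injective (evenIndex : Fin (N / 2) → Fin N) := by
  intro i j h
  simp only [evenIndex, Fin.mk.injEq] at h
  omega

theorem oddIndex_injective : Function.Injective (oddIndex : Fin (N / 2) → Fin N) := by
  intro i j h
  simp only [oddIndex, Fin.mk.injEq] at h
  omega

theorem evenIndex_ne_oddIndex (i j : Fin (N / 2)) : evenIndex i ≠ oddIndex j := by
  simp only [evenIndex, oddIndex, ne_eq, Fin.mk.injEq]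
  omega

/-- The elements of `I` whose images under `c` occur in the word `a`. -/
noncomputable def hitSet {α ι : Type*} (c : ι → α) (I : Finset ι) (a : Fin ℓ → α) : Finset ι :=
  open Classical in I.filter fun i => ∃ k, a k = c i

/-- Choose p with `a p` = 2t and q with `b q` = 2t+1. Flipping at p and q changes only v_(2t) and
w_(2t+1) among the entries involved, so the identities of other pairs are preserved, while one of
the four flip combinations breaks the identity of t. The factors 3/4 therefore multiply. -/
theorem signCommProb_le_pow (a b : Fin ℓ → Fin N) :
    signCommProb a b ≤
      (3 / 4 : ℝ) ^ (hitSet oddIndex (hitSet evenIndex Finset.univ a) b).card := by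
  let v : Fin N → (Fin ℓ → Bool) → ℤ := fun i ε => superdiagonal i (letterWalkEnd a ε)
  let w : Fin N → (Fin ℓ → Bool) → ℤ := fun i ε => superdiagonal i (letterWalkEnd b ε)
  let E : Fin (N / 2) → (Fin ℓ → Bool) × (Fin ℓ → Bool) → Prop := fun i s =>
    v (evenIndex i) s.1 * w (oddIndex i) s.2 = w (evenIndex i) s.2 * v (oddIndex i) s.1
  have main : ∀ T ⊆ hitSet oddIndex (hitSet evenIndex Finset.univ a) b,
      pr (fun s => ∀ i ∈ T, E i s) ≤ (3 / 4 : ℝ) ^ T.card := by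
    intro T
    induction T using Finset.induction_on with
    | empty => intro _; simpa using pr_le_one _
    | insert t T ht ih =>
      intro hT
      have htm := hT (Finset.mem_insert_self t T)
      simp only [hitSet, Finset.mem_filter, Finset.mem_univ, true_and] at htm
      obtain ⟨⟨p, hp⟩, q, hq⟩ := htm
      have hv : ∀ i ≠ t, ∀ c ε, v (evenIndex i) (signFlip p c ε) = v (evenIndex i) ε :=
        fun i hi c ε => superdiagonal_signFlip_of_ne
          (hp ▸ fun h => hi (evenIndex_injective h).symm) c ε
      have hv' : ∀ i c ε, v (oddIndex i) (signFlip p c ε) = v (oddIndex i) ε :=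
        fun i c ε => superdiagonal_signFlip_of_ne (hp ▸ evenIndex_ne_oddIndex t i) c ε
      have hw : ∀ i ≠ t, ∀ c ε, w (oddIndex i) (signFlip q c ε) = w (oddIndex i) ε :=
        fun i hi c ε => superdiagonal_signFlip_of_ne
          (hq ▸ fun h => hi (oddIndex_injective h).symm) c ε
      have hw' : ∀ i c ε, w (evenIndex i) (signFlip q c ε) = w (evenIndex i) ε :=
        fun i c ε => superdiagonal_signFlip_of_ne (hq ▸ (evenIndex_ne_oddIndex i t).symm) c ε
      have h := pr_and_le_of_perm
        (fun c : Bool × Bool => (signFlip p c.1).prodCongr (signFlip q c.2))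
        (fun s => ∀ i ∈ T, E i s) (E t) ?_ ?_
      · rw [Finset.card_insert_of_notMem ht, pow_succ']
        refine le_trans (le_of_eq (pr_congr fun s => ?_)) (h.trans ?_)
        · rw [Finset.forall_mem_insert, and_comm]
        · norm_num
          exact ih ((Finset.subset_insert t T).trans hT)
      · rintro ⟨c, d⟩ ⟨ε, δ⟩ hX i hi
        have hit : i ≠ t := fun h => ht (h ▸ hi)
        have := hX i hi
        simp only [E] at this
        simpa only [E, Equiv.prodCongr_apply, Prod.map, hv i hit, hv', hw i hit, hw'] using this
      · rintro ⟨ε, δ⟩ -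
        -- If xy stays constant for x and y each taking two distinct values, then both values of x
        -- times the difference of the y values vanish, so both values of x are 0.
        by_contra! hall
        have h00 := hall (false, false)
        have h01 := hall (false, true)
        have h10 := hall (true, false)
        have h11 := hall (true, true)
        simp only [E, Equiv.prodCongr_apply, Prod.map, hv', hw', signFlip_false] at h00 h01 h10 h11
        have hδ : w (oddIndex t) (signFlip q true δ) - w (oddIndex t) δ ≠ 0 :=
          sub_ne_zero.2 (superdiagonal_signFlip_ne hq δ)
        have hε : v (evenIndex t) (signFlip p true ε) ≠ v (evenIndex t) ε :=
          superdiagonal_signFlip_ne hp ε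
        have e1 : v (evenIndex t) ε * (w (oddIndex t) (signFlip q true δ) - w (oddIndex t) δ) = 0 := by
          rw [mul_sub, h01, h00, sub_self]
        have e2 : v (evenIndex t) (signFlip p true ε) *
            (w (oddIndex t) (signFlip q true δ) - w (oddIndex t) δ) = 0 := by
          rw [mul_sub, h11, h10, sub_self]
        exact hε (((mul_eq_zero.1 e2).resolve_right hδ).trans
          ((mul_eq_zero.1 e1).resolve_right hδ).symm)
  refine le_trans (pr_mono fun s hs i _ => ?_) (main _ subset_rfl)
  exact superdiagonal_mul_comm_of_commute rfl hs

end SignFlips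

/-! ### Concentration of the number of letters hit -/

section Occupancy

open scoped BigOperators Classical

variable {α ι : Type*} [Fintype α] [Nonempty α] {ℓ : ℕ}

/-- The probability that a fixed letter occurs in a uniform word of length `ℓ` over an alphabet
with `N` letters. -/
noncomputable def hitProb (N ℓ : ℕ) : ℝ := 1 - (1 - 1 / (N : ℝ)) ^ ℓ

theorem hitProb_le_one {N : ℕ} (ℓ : ℕ) (hN : 1 ≤ N) : hitProb N ℓ ≤ 1 := by
  have h1 : (1 : ℝ) ≤ N := by exact_mod_cast hN
  have h2 : 1 / (N : ℝ) ≤ 1 := (div_le_one (by linarith)).2 h1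
  rw [hitProb, sub_le_self_iff]
  exact pow_nonneg (by linarith) _

/-- Chebyshev's inequality for the number of given letters occurring in a uniform word. -/
theorem pr_card_hitSet_lt_le {c : ι → α} (hc : Function.Injective c) (I : Finset ι)
    (h0 : 0 < (I.card : ℝ) * hitProb (Fintype.card α) ℓ) :
    pr (fun a : Fin ℓ → α =>
      ((hitSet c I a).card : ℝ) < I.card * hitProb (Fintype.card α) ℓ / 2) ≤
      4 / (I.card * hitProb (Fintype.card α) ℓ) := by
  set N := Fintype.card α with hNdef
  have hN : 1 ≤ N := Fintype.card_pos
  have hN1 : (1 : ℝ) ≤ N := by exact_mod_cast hN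
  have hN0 : (0 : ℝ) < N := by linarith
  set r : ℝ := (1 - 1 / (N : ℝ)) ^ ℓ with hr
  have hq : hitProb N ℓ = 1 - r := rfl
  have hr0 : 0 ≤ r := by
    have : 1 / (N : ℝ) ≤ 1 := (div_le_one hN0).2 hN1
    exact pow_nonneg (by linarith) _
  have hr1 : r ≤ 1 := by
    refine pow_le_one₀ ?_ ?_
    · have : 1 / (N : ℝ) ≤ 1 := (div_le_one hN0).2 hN1
      linarith
    · rw [sub_le_self_iff]; positivity
  let Y : ι → (Fin ℓ → α) → ℝ := fun i a => if ∀ k, a k ∉ ({c i} : Finset α) then 1 else 0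
  have hY1 : ∀ i, 𝔼 a, Y i a = r := by
    intro i
    have h := pr_forall_notMem (ℓ := ℓ) ({c i} : Finset α)
    rw [Finset.card_singleton, Nat.cast_one, ← hNdef] at h
    rw [hr, ← h, pr]
    congr!
  have hYY : ∀ i a, Y i a * Y i a = Y i a := by
    intro i a
    simp only [Y]
    split_ifs <;> norm_num
  have hY2 : ∀ i j, i ≠ j → 𝔼 a, Y i a * Y j a ≤ r ^ 2 := by
    intro i j hij
    have h := pr_forall_notMem (ℓ := ℓ) ({c i, c j} : Finset α)
    rw [Finset.card_pair (hc.ne hij), ← hNdef] at h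
    have h2 : 𝔼 a, Y i a * Y j a = (1 - ((2 : ℕ) : ℝ) / N) ^ ℓ := by
      rw [← h, pr]
      refine Finset.expect_congr rfl fun a _ => ?_
      have : (∀ k, a k ∉ ({c i, c j} : Finset α)) ↔
          (∀ k, a k ∉ ({c i} : Finset α)) ∧ ∀ k, a k ∉ ({c j} : Finset α) := by
        rw [← forall_and]
        simp
      simp only [Y, this]
      by_cases h1 : ∀ k, a k ∉ ({c i} : Finset α) <;>
        by_cases h2 : ∀ k, a k ∉ ({c j} : Finset α) <;> simp only [h1, h2] <;> simp
    rw [h2, hr, ← pow_mul, mul_comm ℓ 2, pow_mul]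
    -- Missing two given letters is negatively correlated, as 1 - 2/N ≤ (1 - 1/N)²; taking powers
    -- needs 1 - 2/N ≥ 0, which holds since two distinct letters exist.
    have hN2 : (2 : ℝ) ≤ N := by
      have := Finset.card_le_univ ({c i, c j} : Finset α)
      rw [Finset.card_pair (hc.ne hij), ← hNdef] at this
      exact_mod_cast this
    refine pow_le_pow_left₀ ?_ ?_ _
    · have : ((2 : ℕ) : ℝ) / N ≤ 1 := (div_le_one hN0).2 (by exact_mod_cast hN2)
      linarith
    · have : (0 : ℝ) ≤ (1 / (N : ℝ)) ^ 2 := by positivity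
      have e : ((2 : ℕ) : ℝ) / N = 2 * (1 / (N : ℝ)) := by push_cast; ring
      rw [e]
      nlinarith
  have hdev : ∀ a : Fin ℓ → α, ((hitSet c I a).card : ℝ) - I.card * hitProb N ℓ =
      - ∑ i ∈ I, (Y i a - r) := by
    intro a
    have h1 : ((hitSet c I a).card : ℝ) = ∑ i ∈ I, (1 - Y i a) := by
      rw [hitSet, Finset.card_filter]
      push_cast
      refine Finset.sum_congr rfl fun i _ => ?_
      have : (∃ k, a k = c i) ↔ ¬ ∀ k, a k ∉ ({c i} : Finset α) := by simp
      simp only [this, Y]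
      split_ifs <;> simp
    rw [h1, hq, ← Finset.sum_neg_distrib, mul_comm, mul_comm, ← nsmul_eq_mul, ← Finset.sum_const,
      ← Finset.sum_sub_distrib]
    exact Finset.sum_congr rfl fun i _ => by ring
  -- The variance is at most the mean: covariances are nonpositive, and each diagonal term is r - r²
  -- ≤ 1 - r.
  have hvar : 𝔼 a : Fin ℓ → α, (((hitSet c I a).card : ℝ) - I.card * hitProb N ℓ) ^ 2 ≤
      I.card * hitProb N ℓ := by
    calc 𝔼 a : Fin ℓ → α, (((hitSet c I a).card : ℝ) - I.card * hitProb N ℓ) ^ 2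
        = ∑ i ∈ I, ∑ j ∈ I, 𝔼 a, (Y i a - r) * (Y j a - r) := by
          simp only [hdev, sq, neg_mul_neg, Finset.sum_mul_sum]
          rw [Finset.expect_sum_comm]
          refine Finset.sum_congr rfl fun i _ => ?_
          rw [Finset.expect_sum_comm]
      _ ≤ ∑ i ∈ I, ∑ j ∈ I, if i = j then hitProb N ℓ else 0 := by
          refine Finset.sum_le_sum fun i _ => Finset.sum_le_sum fun j _ => ?_
          have e : 𝔼 a, (Y i a - r) * (Y j a - r) = 𝔼 a, Y i a * Y j a - r ^ 2 := by
            have : ∀ a, (Y i a - r) * (Y j a - r) = Y i a * Y j a - r * Y j a - Y i a * r + r ^ 2 :=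
              fun a => by ring
            simp only [this, Finset.expect_add_distrib, Finset.expect_sub_distrib,
              ← Finset.mul_expect, ← Finset.expect_mul, hY1, Fintype.expect_const]
            ring
          rw [e]
          split_ifs with hij
          · subst hij
            simp only [hYY, hY1, hq]
            nlinarith
          · linarith [hY2 i j hij]
      _ = I.card * hitProb N ℓ := by
          simp
  set μ : ℝ := I.card * hitProb N ℓ with hμ
  have hmarkov : pr (fun a : Fin ℓ → α => ((hitSet c I a).card : ℝ) < μ / 2) ≤
      𝔼 a : Fin ℓ → α, (((hitSet c I a).card : ℝ) - μ) ^ 2 * (4 / μ ^ 2) := by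
    refine Finset.expect_le_expect fun a _ => ?_
    split_ifs with h
    · rw [mul_div_assoc', le_div_iff₀ (by positivity)]
      nlinarith
    · positivity
  rw [← Finset.expect_mul] at hmarkov
  calc _ ≤ _ := hmarkov
    _ ≤ μ * (4 / μ ^ 2) := by gcongr
    _ = 4 / μ := by field_simp

end Occupancy

/-! ### Many letters: the commuting probability -/

section Dense

open scoped BigOperators Classical

/-- With s pairs and hit probability q, typically a hits at least sq/2 even indices, and b hits the
odd partners of at least sq²/4 of these. The constant 28 is 4 + 8 + 16: Chebyshev for a, Chebyshev
for b, and the sign bound exp(-sq²/16) ≤ 16/(sq²). -/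
theorem expect_signCommProb_le_div {N ℓ : ℕ} (hN : 2 ≤ N) (hq : 0 < hitProb N ℓ) :
    𝔼 a : Fin ℓ → Fin N, 𝔼 b : Fin ℓ → Fin N, signCommProb a b ≤
      28 / (((N / 2 : ℕ) : ℝ) * hitProb N ℓ ^ 2) := by
  have : Nonempty (Fin N) := ⟨⟨0, by omega⟩⟩
  set q := hitProb N ℓ with hqdef
  set s : ℝ := ((N / 2 : ℕ) : ℝ) with hs
  have hs0 : 0 < s := by
    have : 0 < N / 2 := by omega
    rw [hs]
    exact_mod_cast this
  have hq1 : q ≤ 1 := hitProb_le_one ℓ (by omega)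
  have hcheb : ∀ (c : Fin (N / 2) → Fin N) (_ : Function.Injective c) (I : Finset (Fin (N / 2))),
      0 < (I.card : ℝ) →
      pr (fun a : Fin ℓ → Fin N => ((hitSet c I a).card : ℝ) < I.card * q / 2) ≤
        4 / (I.card * q) := by
    intro c hc I hI
    have := pr_card_hitSet_lt_le (ℓ := ℓ) hc I (by rw [Fintype.card_fin]; positivity)
    simpa only [Fintype.card_fin] using this
  have h1 := hcheb evenIndex evenIndex_injective Finset.univ
    (by rw [Finset.card_univ, Fintype.card_fin]; exact hs0)
  simp only [Finset.card_univ, Fintype.card_fin, ← hs] at h1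
  have hinner : ∀ a : Fin ℓ → Fin N, 𝔼 b : Fin ℓ → Fin N, signCommProb a b ≤
      (if ((hitSet evenIndex Finset.univ a).card : ℝ) < s * q / 2 then 1 else 0) +
        24 / (s * q ^ 2) := by
    intro a
    split_ifs with h
    · have : 𝔼 b : Fin ℓ → Fin N, signCommProb a b ≤ 1 :=
        Finset.expect_le Finset.univ_nonempty fun b _ => pr_le_one _
      have : 0 ≤ 24 / (s * q ^ 2) := by positivity
      linarith
    · set J := hitSet evenIndex Finset.univ a with hJ
      rw [not_lt] at h
      have hJ0 : (0 : ℝ) < J.card := lt_of_lt_of_le (by positivity) h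
      have h2 := hcheb oddIndex oddIndex_injective J hJ0
      have h3 : ∀ b : Fin ℓ → Fin N, signCommProb a b ≤
          (if ((hitSet oddIndex J b).card : ℝ) < J.card * q / 2 then 1 else 0) +
            16 / (s * q ^ 2) := by
        intro b
        split_ifs with h'
        · have : signCommProb a b ≤ 1 := pr_le_one _
          have : 0 ≤ 16 / (s * q ^ 2) := by positivity
          linarith
        · rw [not_lt] at h'
          have h4 : s * q ^ 2 / 4 ≤ (hitSet oddIndex J b).card := by nlinarith
          calc signCommProb a b ≤ (3 / 4 : ℝ) ^ (hitSet oddIndex J b).card :=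
                signCommProb_le_pow a b
            _ ≤ Real.exp (-(1 / 4)) ^ (hitSet oddIndex J b).card := by
                have := Real.one_sub_le_exp_neg (1 / 4)
                exact pow_le_pow_left₀ (by norm_num) (by linarith) _
            _ = Real.exp (-((hitSet oddIndex J b).card / 4)) := by
                rw [← Real.exp_nat_mul]; ring_nf
            _ ≤ Real.exp (-(s * q ^ 2 / 16)) := Real.exp_le_exp.2 (by linarith)
            _ ≤ (s * q ^ 2 / 16)⁻¹ := by
                rw [Real.exp_neg]
                refine inv_anti₀ (by positivity) ?_
                linarith [Real.add_one_le_exp (s * q ^ 2 / 16)]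
            _ = 0 + 16 / (s * q ^ 2) := by rw [inv_div, zero_add]
      have h5 : 𝔼 b : Fin ℓ → Fin N, signCommProb a b ≤
          pr (fun b : Fin ℓ → Fin N => ((hitSet oddIndex J b).card : ℝ) < J.card * q / 2) +
            16 / (s * q ^ 2) := by
        refine (Finset.expect_le_expect fun b _ => h3 b).trans_eq ?_
        rw [Finset.expect_add_distrib, Fintype.expect_const, pr]
      have h6 : 4 / (J.card * q) ≤ 8 / (s * q ^ 2) := by
        rw [div_le_div_iff₀ (by positivity) (by positivity)]
        nlinarith
      have h7 : 24 / (s * q ^ 2) = 8 / (s * q ^ 2) + 16 / (s * q ^ 2) := by ring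
      linarith
  have h8 : 𝔼 a : Fin ℓ → Fin N, 𝔼 b : Fin ℓ → Fin N, signCommProb a b ≤
      pr (fun a : Fin ℓ → Fin N =>
        ((hitSet evenIndex Finset.univ a).card : ℝ) < s * q / 2) + 24 / (s * q ^ 2) := by
    refine (Finset.expect_le_expect fun a _ => hinner a).trans_eq ?_
    rw [Finset.expect_add_distrib, Fintype.expect_const, pr]
  have h9 : 4 / (s * q) ≤ 4 / (s * q ^ 2) := by
    gcongr
    nlinarith
  have h10 : 28 / (s * q ^ 2) = 4 / (s * q ^ 2) + 24 / (s * q ^ 2) := by ring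
  linarith

end Dense

/-! ### Limits -/

section Asymptotics

/-- Follows from 1/(1 - x) = 1 + x/(1 - x) ≤ exp(x/(1 - x)). -/
theorem exp_neg_div_le_one_sub_pow {x : ℝ} (hx : x < 1) (n : ℕ) :
    Real.exp (-(n * x / (1 - x))) ≤ (1 - x) ^ n := by
  have h1 : 0 < 1 - x := by linarith
  have h2 : Real.exp (-(x / (1 - x))) ≤ 1 - x := by
    rw [Real.exp_neg, inv_le_comm₀ (Real.exp_pos _) h1]
    have h3 : (1 - x)⁻¹ = x / (1 - x) + 1 := by field_simp; ring
    rw [h3]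
    exact Real.add_one_le_exp _
  calc Real.exp (-(n * x / (1 - x))) = Real.exp (-(x / (1 - x))) ^ n := by
        rw [← Real.exp_nat_mul]; ring_nf
    _ ≤ _ := pow_le_pow_left₀ (Real.exp_pos _).le h2 n

theorem tendsto_probSubgroup_isMulCommutative {L : ℕ → ℕ} {c : ℝ}
    (h : Tendsto (fun N => (L N : ℝ) / √((N + 1 : ℕ) : ℝ)) atTop (𝓝 c)) :
    Tendsto (fun N => probSubgroup (N + 1) (L N) fun G => IsMulCommutative G) atTop
      (𝓝 (Real.exp (-2 * c ^ 2))) := by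
  have hinv : Tendsto (fun N : ℕ => 1 / (N : ℝ)) atTop (𝓝 0) := tendsto_one_div_atTop_nhds_zero_nat
  have hsq : Tendsto (fun N => (L N : ℝ) ^ 2 / N) atTop (𝓝 (c ^ 2)) := by
    have h1 : Tendsto (fun N : ℕ => ((L N : ℝ) / √((N + 1 : ℕ) : ℝ)) ^ 2 * (1 + 1 / (N : ℝ)))
        atTop (𝓝 (c ^ 2 * (1 + 0))) := (h.pow 2).mul (hinv.const_add 1)
    rw [add_zero, mul_one] at h1
    refine h1.congr' ?_
    filter_upwards [eventually_gt_atTop 0] with N hN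
    have hN0 : (0 : ℝ) < N := by exact_mod_cast hN
    rw [div_pow, Real.sq_sqrt (by positivity)]
    push_cast
    field_simp
  -- L/N is the square root of (L²/N)(1/N); this kills the cubic error (L²/N)(L/N).
  have hlin : Tendsto (fun N => (L N : ℝ) / N) atTop (𝓝 0) := by
    have h1 := (hsq.mul hinv).sqrt
    rw [mul_zero, Real.sqrt_zero] at h1
    refine h1.congr fun N => ?_
    rw [div_mul_div_comm, mul_one, ← sq, ← div_pow]
    exact Real.sqrt_sq (by positivity)
  refine tendsto_of_tendsto_of_tendsto_of_le_of_le'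
    (g := fun N : ℕ => Real.exp (-(2 * ((L N : ℝ) ^ 2 / N) / (1 - 2 * ((L N : ℝ) / N)))))
    (h := fun N : ℕ => Real.exp (-(2 * ((L N : ℝ) ^ 2 / N))) +
      4 * (((L N : ℝ) ^ 2 / N) * (1 / (N : ℝ))) +
        10 * (((L N : ℝ) ^ 2 / N) * ((L N : ℝ) / N))) ?_ ?_ ?_ ?_
  · have h1 := ((hsq.const_mul 2).div ((hlin.const_mul 2).const_sub 1) (by norm_num)).neg
    have e : -2 * c ^ 2 = -(2 * c ^ 2 / (1 - 2 * 0)) := by ring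
    rw [e]
    exact (Real.continuous_exp.tendsto _).comp h1
  · have h1 := (((Real.continuous_exp.tendsto _).comp (hsq.const_mul 2).neg).add
      ((hsq.mul hinv).const_mul 4)).add ((hsq.mul hlin).const_mul 10)
    have e : Real.exp (-2 * c ^ 2) =
        Real.exp (-(2 * c ^ 2)) + 4 * (c ^ 2 * 0) + 10 * (c ^ 2 * 0) := by
      rw [neg_mul]; ring
    rw [e]
    exact h1
  · have h1 : ∀ᶠ N : ℕ in atTop, (L N : ℝ) / N < 1 / 2 := hlin.eventually_lt_const (by norm_num)
    filter_upwards [h1, eventually_gt_atTop 0] with N h2 hN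
    have hN0 : (0 : ℝ) < N := by exact_mod_cast hN
    have h3 : 2 * L N ≤ N := by
      rw [div_lt_iff₀ hN0] at h2
      have : (2 : ℝ) * L N ≤ N := by linarith
      exact_mod_cast this
    rw [probSubgroup_isMulCommutative]
    refine le_trans ?_ (le_expect_signCommProb hN h3)
    have h4 := exp_neg_div_le_one_sub_pow (x := 2 * (L N : ℝ) / N)
      (by rw [mul_div_assoc]; linarith) (L N)
    have e : 2 * ((L N : ℝ) ^ 2 / N) / (1 - 2 * ((L N : ℝ) / N)) =
        L N * (2 * (L N : ℝ) / N) / (1 - 2 * (L N : ℝ) / N) := by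
      rw [mul_div_assoc 2 (L N : ℝ)]; ring
    rw [e]
    exact h4
  · filter_upwards [eventually_ge_atTop 2] with N hN
    rw [probSubgroup_isMulCommutative]
    refine (expect_signCommProb_le hN).trans_eq ?_
    ring_nf

/-- From (1 - 1/N)^ℓ ≤ exp(-ℓ/N) ≤ 1/(1 + ℓ/N). The bound is useful both for ℓ below N and for ℓ far
above it. -/
theorem div_le_hitProb {N : ℕ} (hN : 1 ≤ N) (ℓ : ℕ) : (ℓ : ℝ) / (N + ℓ) ≤ hitProb N ℓ := by
  have hN0 : (1 : ℝ) ≤ N := by exact_mod_cast hN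
  have hN1 : 1 / (N : ℝ) ≤ 1 := (div_le_one (by linarith)).2 hN0
  have h1 : (1 - 1 / (N : ℝ)) ^ ℓ ≤ N / (N + ℓ) := by
    calc (1 - 1 / (N : ℝ)) ^ ℓ ≤ Real.exp (-(1 / (N : ℝ))) ^ ℓ :=
          pow_le_pow_left₀ (by linarith) (Real.one_sub_le_exp_neg _) _
      _ = (Real.exp ((ℓ : ℝ) / N))⁻¹ := by
          rw [← Real.exp_nat_mul, ← Real.exp_neg]; ring_nf
      _ ≤ ((ℓ : ℝ) / N + 1)⁻¹ := inv_anti₀ (by positivity) (Real.add_one_le_exp _)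
      _ = N / (N + ℓ) := by field_simp; ring
  have h2 : (ℓ : ℝ) / (N + ℓ) = 1 - N / (N + ℓ) := by field_simp; ring
  rw [hitProb, h2]
  linarith

theorem probSubgroup_isMulCommutative_le {N ℓ : ℕ} (hN : 2 ≤ N) (hℓ : 1 ≤ ℓ) :
    (probSubgroup (N + 1) ℓ fun G => IsMulCommutative G) ≤
      168 * ((√((N + 1 : ℕ) : ℝ) / ℓ) ^ 2 + 1 / (N : ℝ)) := by
  have hN0 : (2 : ℝ) ≤ N := by exact_mod_cast hN
  have hℓ0 : (1 : ℝ) ≤ ℓ := by exact_mod_cast hℓ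
  have hs : (N : ℝ) / 3 ≤ ((N / 2 : ℕ) : ℝ) := by
    have : N ≤ 3 * (N / 2) := by omega
    have : (N : ℝ) ≤ 3 * ((N / 2 : ℕ) : ℝ) := by exact_mod_cast this
    linarith
  have hq := div_le_hitProb (by omega : 1 ≤ N) ℓ
  have hq0 : 0 < (ℓ : ℝ) / (N + ℓ) := by positivity
  have hs0 : 0 < (N : ℝ) / 3 := by positivity
  have hprod : (N : ℝ) / 3 * ((ℓ : ℝ) / (N + ℓ)) ^ 2 ≤ ((N / 2 : ℕ) : ℝ) * hitProb N ℓ ^ 2 := by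
    gcongr
  have hpos : 0 < (N : ℝ) / 3 * ((ℓ : ℝ) / (N + ℓ)) ^ 2 := by positivity
  rw [probSubgroup_isMulCommutative]
  calc _ ≤ 28 / (((N / 2 : ℕ) : ℝ) * hitProb N ℓ ^ 2) :=
        expect_signCommProb_le_div hN (hq0.trans_le hq)
    _ ≤ 28 / ((N : ℝ) / 3 * ((ℓ : ℝ) / (N + ℓ)) ^ 2) := by gcongr
    _ = 84 * (N + ℓ) ^ 2 / (N * ℓ ^ 2) := by field_simp; ring
    -- This separates the two ranges: N/ℓ² governs short walks and 1/N long ones.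
    _ ≤ 84 * (2 * (N ^ 2 + ℓ ^ 2)) / (N * ℓ ^ 2) := by
        gcongr
        nlinarith [sq_nonneg ((N : ℝ) - ℓ)]
    _ = 168 * (N / ℓ ^ 2 + 1 / (N : ℝ)) := by field_simp; ring
    _ ≤ _ := by
        rw [div_pow, Real.sq_sqrt (by positivity)]
        gcongr
        omega

end Asymptotics

theorem theorem1 (ℓ : ℕ → ℕ) :
    ((fun n => (ℓ n : ℝ)) =o[atTop] (fun n : ℕ => √(n : ℝ)) →
      Tendsto (fun n => probSubgroup n (ℓ n) fun G => IsMulCommutative G) atTop (𝓝 1)) ∧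
    (∀ c : ℝ, Tendsto (fun n => (ℓ n : ℝ) / √(n : ℝ)) atTop (𝓝 c) →
      Tendsto (fun n => probSubgroup n (ℓ n) fun G => IsMulCommutative G) atTop
        (𝓝 (Real.exp (-2 * c ^ 2)))) ∧
    ((fun n : ℕ => √(n : ℝ)) =o[atTop] (fun n => (ℓ n : ℝ)) →
      Tendsto (fun n => probSubgroup n (ℓ n) fun G => ¬ IsMulCommutative G) atTop (𝓝 1)) := by
  have main : ∀ c : ℝ, Tendsto (fun n => (ℓ n : ℝ) / √(n : ℝ)) atTop (𝓝 c) →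
      Tendsto (fun n => probSubgroup n (ℓ n) fun G => IsMulCommutative G) atTop
        (𝓝 (Real.exp (-2 * c ^ 2))) := by
    intro c hc
    rw [← tendsto_add_atTop_iff_nat 1]
    exact tendsto_probSubgroup_isMulCommutative (L := fun N => ℓ (N + 1))
      (hc.comp (tendsto_add_atTop_nat 1))
  refine ⟨fun h => ?_, main, fun h => ?_⟩
  -- The first regime is the case c = 0 of the second.
  · simpa using main 0 h.tendsto_div_nhds_zero
  · rw [← tendsto_add_atTop_iff_nat 1]
    have h1 : Tendsto (fun N : ℕ => √((N + 1 : ℕ) : ℝ) / (ℓ (N + 1) : ℝ)) atTop (𝓝 0) :=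
      h.tendsto_div_nhds_zero.comp (tendsto_add_atTop_nat 1)
    have h2 : Tendsto (fun N : ℕ => 168 * ((√((N + 1 : ℕ) : ℝ) / (ℓ (N + 1) : ℝ)) ^ 2 +
        1 / (N : ℝ))) atTop (𝓝 0) := by
      simpa using ((h1.pow 2).add tendsto_one_div_atTop_nhds_zero_nat).const_mul 168
    -- Division by zero returns 0, so a vanishing quotient √n/ℓ does not itself exclude ℓ = 0; the
    -- little-o bound with constant 1 does.
    have h3 : ∀ᶠ N : ℕ in atTop, 1 ≤ ℓ (N + 1) := by
      filter_upwards [(tendsto_add_atTop_nat 1).eventually (h.bound one_pos)] with N hN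
      by_contra! h0
      rw [Nat.lt_one_iff.1 h0] at hN
      have : 0 < √((N + 1 : ℕ) : ℝ) := Real.sqrt_pos.2 (by positivity)
      simp only [CharP.cast_eq_zero, norm_zero, mul_zero, Real.norm_eq_abs] at hN
      exact absurd (abs_pos.2 this.ne') (not_lt.2 hN)
    have h4 : Tendsto (fun N => probSubgroup (N + 1) (ℓ (N + 1)) fun G => IsMulCommutative G)
        atTop (𝓝 0) := by
      refine squeeze_zero' ?_ ?_ h2
      · exact Eventually.of_forall fun N => measureReal_nonneg
      · filter_upwards [h3, eventually_ge_atTop 2] with N hN hN2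
        exact probSubgroup_isMulCommutative_le hN2 hN
    have h5 := h4.const_sub 1
    rw [sub_zero] at h5
    refine h5.congr' ?_
    filter_upwards [eventually_ge_atTop 1] with N hN
    exact (probSubgroup_not_isMulCommutative hN _).symm
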